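/- Let $n$, $b$ and $a_i,u_i$ ($i\in N:=\{1,\dots,n\}$) be positive integers such that $\{(a_i,u_i)\}_{i\in N}$ is weakly superincreasing, i.e. $\sum_{k=1}^{i}a_ku_k\le a_{i+1}$ for all $1\le i<n$, and let $K=\{x\in\mathbb{Z}^n:\ \sum_{i\in N}a_ix_i\le b,\ 0\le x_i\le u_i\ \forall i\in N\}$. Let $\theta$ be the greedy solution of $K$, defined recursively for $i=n,n-1,\dots,1$ by $$\theta_i=\min\Big\{u_i,\Big\lfloor\frac{b-\sum_{k=i+1}^{n}a_k\theta_k}{a_i}\Big\rfloor\Big\}.$$ Put $I=\{i\in N:\theta_i\ge 1\}$, $I_j=\{i\in I: i>j\}$ for $j\in N$, and $$\phi_j(i)=(u_j-\theta_j)\prod_{k\in I,\ j<k<i}(u_k+1-\theta_k)\qquad (j\in N,\ i\in I_j),$$ where an empty product equals $1$. Then $$\operatorname{conv}(K)=\Big\{x\in\mathbb{R}^n:\ 0\le x_i\le u_i\ \forall i\in N,\quad x_j+\sum_{i\in I_j}\phi_j(i)(x_i-\theta_i)\le\theta_j\ \ \forall j\in N\Big\}.$$ In particular, $\operatorname{conv}(K)$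 is the solution set of a system of $3n$ linear inequalities. -/

import Mathlib

namespace SuperincreasingKnapsack

variable {n : ℕ}

/-- The bounded integer knapsack `{x ∈ ℤⁿ : 0 ≤ x ≤ u, aᵀx ≤ b}`. -/
def knapsack (a u : Fin n → ℤ) (b : ℤ) : Set (Fin n → ℤ) :=
  {x | (∀ i, 0 ≤ x i ∧ x i ≤ u i) ∧ ∑ i, a i * x i ≤ b}

/-- The convex hull in `ℝⁿ` of the knapsack. -/
def knapsackPolytope (a u : Fin n → ℤ) (b : ℤ) : Set (Fin n → ℝ) :=
  convexHull ℝ ((fun (x : Fin n → ℤ) (i : Fin n) => (x i : ℝ)) '' knapsack a u b)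

/-- The tuples `(a i, u i)` form a weakly superincreasing sequence:
`a 1 * u 1 + ... + a i * u i ≤ a (i + 1)` for all `i` such that `i + 1` is an index. -/
def WeaklySuperincreasing (a u : Fin n → ℤ) : Prop :=
  ∀ i j : Fin n, (j : ℕ) = (i : ℕ) + 1 → ∑ k ∈ Finset.Iic i, a k * u k ≤ a j

/-- The greedy solution, computed from the last index down to the first:
`θ i = min (u i) ⌊(b - ∑_{k > i} a k * θ k) / a i⌋`.
(Integer division by a positive integer is the floor of the quotient.) -/
def greedy (a u : Fin n → ℤ) (b : ℤ) (i : Fin n) : ℤ :=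
  min (u i) ((b - ∑ k ∈ (Finset.Ioi i).attach, a k.1 * greedy a u b k.1) / a i)
termination_by n - (i : ℕ)
decreasing_by
  have h : i < k.1 := Finset.mem_Ioi.mp k.2
  have h' : (i : ℕ) < (k.1 : ℕ) := h
  have := k.1.isLt
  omega

/-- The defining recursion of the greedy solution, without the bookkeeping for termination. -/
theorem greedy_eq (a u : Fin n → ℤ) (b : ℤ) (i : Fin n) :
    greedy a u b i =
      min (u i) ((b - ∑ k ∈ Finset.Ioi i, a k * greedy a u b k) / a i) := by
  rw [greedy, Finset.sum_attach (Finset.Ioi i) (fun k => a k * greedy a u b k)]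

/-- The support `I = {i : θ i ≥ 1}`. -/
def support (θ : Fin n → ℤ) : Finset (Fin n) :=
  Finset.univ.filter fun i => 1 ≤ θ i

/-- The part `I_j = {i ∈ I : i > j}` of the support above `j`. -/
def supportAbove (θ : Fin n → ℤ) (j : Fin n) : Finset (Fin n) :=
  (support θ).filter fun i => j < i

/-- The coefficient `φ_j(i) = (u j - θ j) * ∏ (u k + 1 - θ k)`, the product being over the
elements `k` of the support from the one following `j` to the one preceding `i`. -/
def phi (u θ : Fin n → ℤ) (j i : Fin n) : ℤ :=
  (u j - θ j) * ∏ k ∈ (support θ).filter (fun k => j < k ∧ k < i), (u k + 1 - θ k)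

end SuperincreasingKnapsack

/-!
Weak superincreasingness makes the knapsack the set of integer points `x` of the box `[0, u]` that
are colexicographically at most `θ`. The forms `cut_j d = d j + ∑ i ∈ I_j, φ_j(i) * d i` satisfy the
recursion `cut_j d = d j + (u j - θ j) * ∑ i ∈ I_j, cut_i d`.

Validity: let `m` be the largest index at which `x` differs from `θ`, so that `x m ≤ θ m - 1` and
`cut_m (x - θ) ≤ -1`. By the recursion, `x j ≤ u j` then gives `cut_j (x - θ) ≤ 0` for every
`j < m`, by downward induction on `j`.

Completeness: let `x` satisfy the inequalities and let `m` be the largest index at which `x` differs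
from `θ`; then `x m < θ m`. If `x m ≤ θ m - 1`, then `x` lies in a box whose integer points are all
colexicographically below `θ`. Otherwise `x` is a convex combination of such a point and of a point
that satisfies the inequalities and agrees with `θ` from `m` on, and one inducts on `m`.
-/

namespace SuperincreasingKnapsack

open Finset

section General

variable {ι κ : Type*}

/-- An integer vector, seen as a real vector. -/
def castVec (x : ι → ℤ) : ι → ℝ := fun i => x i

@[simp]
theorem castVec_apply (x : ι → ℤ) (i : ι) : castVec x i = x i := rfl

theorem Icc_castVec_subset_convexHull [Finite ι] (l h : ι → ℤ) :
    Set.Icc (castVec l) (castVec h) ⊆ convexHull ℝ (castVec '' Set.Icc l h) := by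
  intro y hy
  have hlh (i : ι) : l i ≤ h i := Int.cast_le.1 ((hy.1 i).trans (hy.2 i))
  have hy_pi : y ∈ convexHull ℝ (Set.univ.pi fun i => {(l i : ℝ), (h i : ℝ)}) := by
    rw [convexHull_pi]
    intro i _
    beta_reduce
    rw [convexHull_pair, segment_eq_Icc (Int.cast_le.2 (hlh i))]
    exact ⟨hy.1 i, hy.2 i⟩
  refine convexHull_mono (fun z hz => ?_) hy_pi
  have hz_int (i : ι) : ∃ t ∈ Set.Icc (l i) (h i), (t : ℝ) = z i := by
    rcases hz i (Set.mem_univ i) with e | e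
    · exact ⟨l i, ⟨le_rfl, hlh i⟩, e.symm⟩
    · exact ⟨h i, ⟨hlh i, le_rfl⟩, e.symm⟩
  choose t ht htz using hz_int
  exact ⟨t, ⟨fun i => (ht i).1, fun i => (ht i).2⟩, funext htz⟩

theorem exists_matrix_setOf_forall_le [Fintype ι] {N : ℕ} (e : Fin N ≃ κ)
    (f : κ → (ι → ℝ) →ₗ[ℝ] ℝ) (c : κ → ℝ) :
    ∃ (A : Matrix (Fin N) ι ℝ) (d : Fin N → ℝ),
      {x : ι → ℝ | ∀ k, f k x ≤ c k} = {x | ∀ r, ∑ i, A r i * x i ≤ d r} := by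
  classical
  refine ⟨.of fun r i => f (e r) fun j => if i = j then 1 else 0, c ∘ e, ?_⟩
  ext x
  simp only [Set.mem_ofPred_eq, ← e.forall_congr_right (q := fun k => f k x ≤ c k)]
  refine forall_congr' fun r => ?_
  rw [LinearMap.pi_apply_eq_sum_univ]
  simp only [Matrix.of_apply, smul_eq_mul, mul_comm, Function.comp_apply]

theorem mem_segment_inv_smul_inf_sup_zero {x v w : ι → ℝ} {s : ℝ} (hs0 : 0 < s) (hs1 : s ≤ 1)
    (h : x = s • v + (1 - s) • w) : x ∈ segment ℝ (s⁻¹ • x ⊓ v) (w ⊔ 0) := by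
  refine ⟨s, 1 - s, hs0.le, sub_nonneg.2 hs1, add_sub_cancel _ _, funext fun i => ?_⟩
  have hi : x i = s * v i + (1 - s) * w i := congrFun h i
  change s * min (s⁻¹ * x i) (v i) + (1 - s) * max (w i) 0 = x i
  rw [mul_min_of_nonneg _ _ hs0.le, mul_inv_cancel_left₀ hs0.ne']
  rcases le_total (w i) 0 with hw | hw
  · have hxv : x i ≤ s * v i := by
      linarith [mul_nonpos_of_nonneg_of_nonpos (sub_nonneg.2 hs1) hw]
    rw [max_eq_right hw, min_eq_left hxv, mul_zero, add_zero]
  · have hvx : s * v i ≤ x i := by linarith [mul_nonneg (sub_nonneg.2 hs1) hw]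
    rw [max_eq_left hw, min_eq_right hvx, hi]

theorem sum_eq_add_sum_Ioi_add_sum_Iio {M : Type*} [AddCommMonoid M] [LinearOrder ι] [Fintype ι]
    [LocallyFiniteOrderBot ι] [LocallyFiniteOrderTop ι] (f : ι → M) (m : ι) :
    ∑ i, f i = f m + (∑ i ∈ Ioi m, f i + ∑ i ∈ Iio m, f i) := by
  rw [Fintype.sum_eq_add_sum_compl m, ← Ioi_disjUnion_Iio, sum_disjUnion]

/-- The integer points of the box `[0, u]` that are colexicographically at most `θ`, i.e. with the
largest index being the most significant one. -/
def colexBox [LinearOrder ι] (u θ : ι → ℤ) : Set (ι → ℤ) :=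
  {x | x ∈ Set.Icc 0 u ∧ toColex x ≤ toColex θ}

end General

variable {n : ℕ} {a u θ : Fin n → ℤ} {b : ℤ} {j m : Fin n}

section Greedy

theorem greedy_le (a u : Fin n → ℤ) (b : ℤ) : greedy a u b ≤ u := fun j => by
  rw [greedy_eq]
  exact min_le_left _ _

theorem mul_greedy_le (ha : 0 < a j) :
    a j * greedy a u b j ≤ b - ∑ k ∈ Ioi j, a k * greedy a u b k := by
  rw [greedy_eq]
  exact (mul_le_mul_of_nonneg_left (min_le_right _ _) ha.le).trans (Int.mul_ediv_self_le ha.ne')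

theorem sum_mul_greedy_le (ha : ∀ i, 0 < a i) (hb : 0 ≤ b) {s : Finset (Fin n)}
    (hs : IsUpperSet (s : Set (Fin n))) : ∑ k ∈ s, a k * greedy a u b k ≤ b := by
  rcases s.eq_empty_or_nonempty with rfl | hne
  · simpa using hb
  · have hs_Ici : s = Ici (s.min' hne) := by
      ext k
      rw [mem_Ici]
      exact ⟨s.min'_le k, fun hk => hs hk (s.min'_mem hne)⟩
    rw [hs_Ici, ← add_sum_Ioi_eq_sum_Ici]
    linarith [mul_greedy_le (u := u) (b := b) (ha (s.min' hne))]

theorem greedy_nonneg (ha : ∀ i, 0 < a i) (hu : 0 ≤ u) (hb : 0 ≤ b) : 0 ≤ greedy a u b := by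
  intro j
  rw [greedy_eq]
  have hrest : ∑ k ∈ Ioi j, a k * greedy a u b k ≤ b :=
    sum_mul_greedy_le ha hb (by simpa using isUpperSet_Ioi j)
  exact le_min (hu j) (Int.ediv_nonneg (sub_nonneg.2 hrest) (ha j).le)

theorem le_greedy_of_eq_above (ha : ∀ i, 0 < a i) {x : Fin n → ℤ} (hx : x ∈ knapsack a u b)
    (h : ∀ i, j < i → x i = greedy a u b i) : x j ≤ greedy a u b j := by
  rw [greedy_eq]
  refine le_min (hx.1 j).2 ((Int.le_ediv_iff_mul_le (ha j)).2 ?_)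
  have hsum := hx.2
  have hhigh : ∑ k ∈ Ioi j, a k * x k = ∑ k ∈ Ioi j, a k * greedy a u b k :=
    sum_congr rfl fun k hk => congrArg (a k * ·) (h k (mem_Ioi.1 hk))
  rw [sum_eq_add_sum_Ioi_add_sum_Iio _ j, hhigh] at hsum
  have hlow : 0 ≤ ∑ k ∈ Iio j, a k * x k :=
    sum_nonneg fun k _ => mul_nonneg (ha k).le (hx.1 k).1
  linarith

theorem WeaklySuperincreasing.sum_Iio_le (h : WeaklySuperincreasing a u) (hj : 0 ≤ a j) :
    ∑ k ∈ Iio j, a k * u k ≤ a j := by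
  by_cases hmin : IsMin j
  · simpa [Finset.Iio_eq_empty.2 hmin] using hj
  · rw [← Iic_pred_eq_Iio_of_not_isMin hmin]
    refine h _ _ (Eq.symm ?_)
    exact Nat.covBy_iff_add_one_eq.1 (Fin.covBy_iff.1 (Order.pred_covBy_of_not_isMin hmin))

theorem knapsack_eq_colexBox (ha : ∀ i, 0 < a i) (hb : 0 ≤ b)
    (hsup : WeaklySuperincreasing a u) : knapsack a u b = colexBox u (greedy a u b) := by
  refine Set.Subset.antisymm (fun x hx => ⟨⟨fun i => (hx.1 i).1, fun i => (hx.1 i).2⟩, ?_⟩) ?_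
  · refine le_of_not_gt ?_
    rintro ⟨m, habove, hlt⟩
    exact hlt.not_ge (le_greedy_of_eq_above ha hx fun i hi => (habove i hi).symm)
  · rintro x ⟨hx, hle⟩
    refine ⟨fun i => ⟨hx.1 i, hx.2 i⟩, ?_⟩
    rcases hle.eq_or_lt with heq | ⟨m, habove, hlt⟩
    · rw [toColex_inj.1 heq]
      exact sum_mul_greedy_le ha hb (by simpa using isUpperSet_univ)
    · have hlow : ∑ k ∈ Iio m, a k * x k ≤ a m :=
        (sum_le_sum fun k _ => mul_le_mul_of_nonneg_left (hx.2 k) (ha k).le).trans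
          (hsup.sum_Iio_le (ha m).le)
      have hhigh : ∑ k ∈ Ioi m, a k * x k = ∑ k ∈ Ioi m, a k * greedy a u b k :=
        sum_congr rfl fun k hk => congrArg (a k * ·) (habove k (mem_Ioi.1 hk))
      have hm : a m * (x m + 1) ≤ a m * greedy a u b m :=
        mul_le_mul_of_nonneg_left (Int.add_one_le_of_lt hlt) (ha m).le
      rw [sum_eq_add_sum_Ioi_add_sum_Iio _ m, hhigh]
      linarith [mul_greedy_le (u := u) (b := b) (ha m)]

end Greedy

section Cut

variable {d d' : Fin n → ℝ}

@[simp]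
theorem mem_supportAbove {i : Fin n} : i ∈ supportAbove θ j ↔ 1 ≤ θ i ∧ j < i := by
  simp [supportAbove, support]

theorem phi_eq (u θ : Fin n → ℤ) (j i : Fin n) :
    phi u θ j i = (u j - θ j) * (1 + ∑ k ∈ supportAbove θ j with k < i, phi u θ k i) := by
  have hprod : ∏ k ∈ support θ with j < k ∧ k < i, (1 + (u k - θ k)) =
      1 + ∑ k ∈ support θ with j < k ∧ k < i,
        (u k - θ k) * ∏ l ∈ (support θ).filter (fun l => j < l ∧ l < i) with k < l,
          (1 + (u l - θ l)) :=
    prod_one_add_ordered (ι := (Fin n)ᵒᵈ) _ _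
  have hfactor (l : Fin n) : u l + 1 - θ l = 1 + (u l - θ l) := by ring
  simp only [phi, hfactor, hprod]
  congr 2
  refine sum_congr (by ext k; simp [support, and_assoc]) fun k hk => ?_
  have hjk : j < k := (mem_supportAbove.1 (mem_filter.1 hk).1).2
  congr 2
  ext l
  simp only [mem_filter]
  exact ⟨fun h => ⟨h.1.1, h.2, h.1.2.2⟩, fun h => ⟨⟨h.1, hjk.trans h.2.1, h.2.2⟩, h.2.1⟩⟩

/-- The linear form `d ↦ d j + ∑ i ∈ I_j, φ_j(i) * d i`; the `j`-th inequality of the description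
says that it is nonpositive at the displacement `d = x - θ`. -/
noncomputable def cut (u θ : Fin n → ℤ) (j : Fin n) : (Fin n → ℝ) →ₗ[ℝ] ℝ :=
  LinearMap.proj (R := ℝ) (φ := fun _ : Fin n => ℝ) j +
    ∑ i ∈ supportAbove θ j, (phi u θ j i : ℝ) • LinearMap.proj i

theorem cut_apply (u θ : Fin n → ℤ) (j : Fin n) (d : Fin n → ℝ) :
    cut u θ j d = d j + ∑ i ∈ supportAbove θ j, phi u θ j i * d i := by
  simp [cut]

theorem cut_eq_add_mul_sum (u θ : Fin n → ℤ) (j : Fin n) (d : Fin n → ℝ) :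
    cut u θ j d = d j + (u j - θ j) * ∑ i ∈ supportAbove θ j, cut u θ i d := by
  have hswap : ∑ i ∈ supportAbove θ j, ∑ k ∈ supportAbove θ i, (phi u θ i k : ℝ) * d k =
      ∑ k ∈ supportAbove θ j, ∑ i ∈ supportAbove θ j with i < k, (phi u θ i k : ℝ) * d k :=
    sum_comm' fun i k => by
      simp only [mem_supportAbove, mem_filter]
      grind
  simp only [cut_apply, sum_add_distrib, hswap]
  rw [← sum_add_distrib, mul_sum]
  congr 1
  refine sum_congr rfl fun k _ => ?_
  rw [phi_eq, ← sum_mul]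
  push_cast
  ring

theorem cut_sub_of_eq_above {x : Fin n → ℝ} (h : ∀ i, j < i → x i = θ i) :
    cut u θ j (x - castVec θ) = x j - θ j := by
  rw [cut_apply]
  exact add_eq_left.2 <| sum_eq_zero fun i hi => by simp [h i (mem_supportAbove.1 hi).2]

theorem cut_le_self (hθj : θ j ≤ u j) (hcut : ∀ i, j < i → cut u θ i d ≤ 0) :
    cut u θ j d ≤ d j := by
  rw [cut_eq_add_mul_sum, add_le_iff_nonpos_right]
  exact mul_nonpos_of_nonneg_of_nonpos (sub_nonneg.2 (Int.cast_le.2 hθj))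
    (sum_nonpos fun i hi => hcut i (mem_supportAbove.1 hi).2)

theorem cut_nonpos_of_cut_le_neg_one (hθj : θ j ≤ u j) (hd : d j ≤ u j - θ j)
    (hcut : ∀ i, j < i → cut u θ i d ≤ 0) (hm : m ∈ supportAbove θ j)
    (hcutm : cut u θ m d ≤ -1) : cut u θ j d ≤ 0 := by
  have hsum : ∑ i ∈ supportAbove θ j, cut u θ i d ≤ -1 := by
    rw [← add_sum_erase _ _ hm]
    exact (add_le_of_nonpos_right <| sum_nonpos fun i hi =>
      hcut i (mem_supportAbove.1 (mem_of_mem_erase hi)).2).trans hcutm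
  have hmul := mul_le_mul_of_nonneg_left hsum (sub_nonneg.2 (Int.cast_le (R := ℝ).2 hθj))
  rw [cut_eq_add_mul_sum]
  linarith

/-- Clipping coordinates of `x = θ + d` to `0` preserves the inequalities, as long as the result
stays below `u`. -/
theorem cut_nonpos_of_eq_or_eq_neg (hθ : θ ∈ Set.Icc 0 u) (hd'u : ∀ i, d' i ≤ u i - θ i)
    (hd' : ∀ i, d' i = d i ∨ d' i = -θ i) (hcut : ∀ i, cut u θ i d ≤ 0) :
    cut u θ j d' ≤ 0 := by
  induction j using WellFoundedGT.induction with
  | ind j ih =>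
  by_cases hagree : ∀ i ∈ supportAbove θ j, d' i = d i
  · have hsub : cut u θ j d' - d' j = cut u θ j d - d j := by
      simp only [cut_apply, add_sub_cancel_left]
      exact sum_congr rfl fun i hi => by rw [hagree i hi]
    have hle : cut u θ j d ≤ d j := cut_le_self (hθ.2 j) fun i _ => hcut i
    have hθj : (0 : ℝ) ≤ θ j := Int.cast_nonneg (hθ.1 j)
    rcases hd' j with h | h <;> linarith [hcut j]
  · push Not at hagree
    obtain ⟨i, hi, hne⟩ := hagree
    obtain ⟨hIi, hji⟩ := mem_supportAbove.1 hi
    refine cut_nonpos_of_cut_le_neg_one (hθ.2 j) (hd'u j) ih hi ?_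
    calc cut u θ i d' ≤ d' i := cut_le_self (hθ.2 i) fun k hk => ih k (hji.trans hk)
      _ = -θ i := (hd' i).resolve_left hne
      _ ≤ -1 := neg_le_neg (by exact_mod_cast hIi)

end Cut

section Polytope

/-- The polytope cut out of the box `[0, u]` by the inequalities `cut u θ j (x - θ) ≤ 0`. -/
def cutPolytope (u θ : Fin n → ℤ) : Set (Fin n → ℝ) :=
  {x | x ∈ Set.Icc 0 (castVec u) ∧ ∀ j, cut u θ j (x - castVec θ) ≤ 0}

theorem convex_cutPolytope (u θ : Fin n → ℤ) : Convex ℝ (cutPolytope u θ) := by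
  have hinter : cutPolytope u θ = Set.Icc 0 (castVec u) ∩
      ⋂ j, {x | cut u θ j x ≤ cut u θ j (castVec θ)} := by
    ext x
    simp [cutPolytope]
  rw [hinter]
  exact (convex_Icc _ _).inter <|
    convex_iInter fun j => convex_halfSpace_le (cut u θ j).isLinear _

theorem castVec_mem_cutPolytope (hθ : θ ≤ u) {x : Fin n → ℤ} (hx : x ∈ colexBox u θ) :
    castVec x ∈ cutPolytope u θ := by
  obtain ⟨⟨hx0, hxu⟩, hle⟩ := hx
  refine ⟨⟨fun i => Int.cast_nonneg (hx0 i), fun i => Int.cast_le.2 (hxu i)⟩, ?_⟩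
  rcases hle.eq_or_lt with heq | ⟨m, habove, hlt⟩
  · simp [toColex_inj.1 heq]
  have habove (i : Fin n) (hi : m < i) : x i = θ i := habove i hi
  have hlt : x m < θ m := hlt
  have hcut (i : Fin n) (hi : m ≤ i) :
      cut u θ i (castVec x - castVec θ) = x i - θ i :=
    cut_sub_of_eq_above fun k hk => congrArg _ (habove k (hi.trans_lt hk))
  intro j
  induction j using WellFoundedGT.induction with
  | ind j ih =>
  rcases lt_or_ge j m with hj | hj
  · refine cut_nonpos_of_cut_le_neg_one (hθ j) (sub_le_sub_right (Int.cast_le.2 (hxu j)) _) ih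
      (mem_supportAbove.2 ⟨(hx0 m).trans_lt hlt, hj⟩) ?_
    rw [hcut m le_rfl]
    exact_mod_cast (by omega : x m - θ m ≤ -1)
  · rw [hcut j hj, sub_nonpos, Int.cast_le]
    rcases hj.eq_or_lt with rfl | hj
    · exact hlt.le
    · exact (habove j hj).le

/-- The largest integer vector in the box `[0, u]` that agrees with `θ` above `m` and is smaller
than `θ` at `m`. -/
def dropAt (u θ : Fin n → ℤ) (m i : Fin n) : ℤ :=
  if i < m then u i else if i = m then θ m - 1 else θ i

theorem dropAt_of_lt {i : Fin n} (h : i < m) : dropAt u θ m i = u i := if_pos h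

theorem dropAt_self : dropAt u θ m m = θ m - 1 := by simp [dropAt]

theorem dropAt_of_gt {i : Fin n} (h : m < i) : dropAt u θ m i = θ i := by
  simp [dropAt, h.not_gt, h.ne']

theorem dropAt_le (hθ : θ ≤ u) : dropAt u θ m ≤ u := fun i => by
  rcases lt_trichotomy i m with hi | rfl | hi
  · rw [dropAt_of_lt hi]
  · rw [dropAt_self]
    exact (sub_one_lt _).le.trans (hθ i)
  · rw [dropAt_of_gt hi]
    exact hθ i

theorem dropAt_nonneg (hθ : θ ∈ Set.Icc 0 u) (hm : 1 ≤ θ m) : 0 ≤ dropAt u θ m := fun i => by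
  rcases lt_trichotomy i m with hi | rfl | hi
  · rw [dropAt_of_lt hi]
    exact (hθ.1 i).trans (hθ.2 i)
  · rw [dropAt_self]
    exact sub_nonneg.2 hm
  · rw [dropAt_of_gt hi]
    exact hθ.1 i

theorem cut_dropAt (hm : 1 ≤ θ m) (hj : j < m) :
    cut u θ j (castVec (dropAt u θ m) - castVec θ) = 0 := by
  induction j using WellFoundedGT.induction with
  | ind j ih =>
  have hcut (i : Fin n) (hi : m ≤ i) :
      cut u θ i (castVec (dropAt u θ m) - castVec θ) = dropAt u θ m i - θ i :=
    cut_sub_of_eq_above fun k hk => congrArg _ (dropAt_of_gt (hi.trans_lt hk))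
  have hsum : ∑ i ∈ supportAbove θ j, cut u θ i (castVec (dropAt u θ m) - castVec θ) = -1 := by
    rw [sum_eq_single_of_mem m (mem_supportAbove.2 ⟨hm, hj⟩), hcut m le_rfl, dropAt_self]
    · simp
    · intro i hi hne
      rcases hne.lt_or_gt with him | hmi
      · exact ih i (mem_supportAbove.1 hi).2 him
      · rw [hcut i hmi.le, dropAt_of_gt hmi, sub_self]
  rw [cut_eq_add_mul_sum, hsum]
  simp [dropAt_of_lt hj]

theorem mem_convexHull_colexBox_of_le_dropAt (hθ : θ ∈ Set.Icc 0 u) {y : Fin n → ℝ}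
    (hy0 : 0 ≤ y) (hy : y ≤ castVec (dropAt u θ m)) (habove : ∀ i, m < i → y i = θ i) :
    y ∈ convexHull ℝ (castVec '' colexBox u θ) := by
  let l : Fin n → ℤ := fun i => if m < i then θ i else 0
  have hl0 (i : Fin n) : 0 ≤ l i := by
    dsimp only [l]
    split_ifs
    exacts [hθ.1 i, le_rfl]
  have hly : castVec l ≤ y := fun i => by
    dsimp only [castVec, l]
    split_ifs with hi
    · exact (habove i hi).ge
    · simpa using hy0 i
  refine convexHull_mono (Set.image_mono fun x hx => ?_)
    (Icc_castVec_subset_convexHull l _ ⟨hly, hy⟩)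
  refine ⟨⟨fun i => (hl0 i).trans (hx.1 i), hx.2.trans (dropAt_le hθ.2)⟩, le_of_lt ⟨m, ?_, ?_⟩⟩
  · intro i hi
    refine le_antisymm ((hx.2 i).trans_eq (dropAt_of_gt hi)) ?_
    simpa [l, show m < i from hi] using hx.1 i
  · exact Int.lt_of_le_sub_one ((hx.2 m).trans_eq dropAt_self)

theorem le_dropAt {x : Fin n → ℝ} (hx : x ≤ castVec u) (habove : ∀ i, m < i → x i = θ i)
    (hm : x m ≤ θ m - 1) : x ≤ castVec (dropAt u θ m) := fun i => by
  rcases lt_trichotomy i m with hi | rfl | hi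
  · simpa [dropAt_of_lt hi] using hx i
  · simpa [dropAt_self] using hm
  · simp [dropAt_of_gt hi, habove i hi]

/-- The vector `dropAt u θ m` satisfies the inequalities below `m` with equality, so they survive
extrapolation from it through `x`. -/
theorem cut_nonpos_of_extrapolation {x w : Fin n → ℝ} {s : ℝ} (hm : 1 ≤ θ m)
    (hx : cut u θ j (x - castVec θ) ≤ 0) (hs : s < 1)
    (hw : x = s • castVec (dropAt u θ m) + (1 - s) • w) (hwm : ∀ i, m ≤ i → w i = θ i) :
    cut u θ j (w - castVec θ) ≤ 0 := by
  rcases lt_or_ge j m with hj | hj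
  · have hsub : x - castVec θ =
        s • (castVec (dropAt u θ m) - castVec θ) + (1 - s) • (w - castVec θ) := by
      rw [hw]
      module
    rw [hsub, map_add, map_smul, map_smul, cut_dropAt hm hj, smul_zero, zero_add] at hx
    exact nonpos_of_mul_nonpos_right hx (sub_pos.2 hs)
  · rw [cut_sub_of_eq_above fun i hi => hwm i (hj.trans hi.le), hwm j hj, sub_self]

theorem exists_eq_smul_dropAt_add_smul (hθ : θ ≤ u) {x : Fin n → ℝ} (hx : x ≤ castVec u)
    (habove : ∀ i, m < i → x i = θ i) (hlt : x m < θ m) (hgt : θ m - 1 < x m) :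
    ∃ (s : ℝ) (w : Fin n → ℝ), (0 < s ∧ s < 1) ∧
      x = s • castVec (dropAt u θ m) + (1 - s) • w ∧ w ≤ castVec u ∧ ∀ i, m ≤ i → w i = θ i := by
  obtain ⟨s, hs⟩ : ∃ s, s = θ m - x m := ⟨_, rfl⟩
  have hs0 : 0 < s := by linarith
  have hs1 : 0 < 1 - s := by linarith
  obtain ⟨w, hw⟩ : ∃ w, x = s • castVec (dropAt u θ m) + (1 - s) • w :=
    ⟨(1 - s)⁻¹ • (x - s • castVec (dropAt u θ m)), by
      rw [smul_inv_smul₀ hs1.ne', add_sub_cancel]⟩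
  have hwi (i : Fin n) : x i = s * dropAt u θ m i + (1 - s) * w i := congrFun hw i
  have hwm (i : Fin n) (hi : m ≤ i) : w i = θ i := by
    refine mul_left_cancel₀ hs1.ne' ?_
    have hxi := hwi i
    rcases hi.eq_or_lt with rfl | hi
    · rw [dropAt_self] at hxi
      push_cast at hxi
      linear_combination hs - hxi
    · rw [dropAt_of_gt hi, habove i hi] at hxi
      linear_combination -hxi
  refine ⟨s, w, ⟨hs0, sub_pos.1 hs1⟩, hw, fun i => ?_, hwm⟩
  rcases lt_or_ge i m with hi | hi
  · have hxu : x i ≤ u i := hx i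
    rw [hwi i, dropAt_of_lt hi] at hxu
    refine le_of_mul_le_mul_left ?_ hs1
    rw [castVec_apply]
    linarith
  · rw [hwm i hi]
    exact Int.cast_le.2 (hθ i)

/-- The extrapolated point `w` may have negative coordinates; clipping them to `0` is compensated
by lowering the same coordinates of `dropAt u θ m`. -/
theorem exists_mem_segment_of_mem_cutPolytope (hθ : θ ∈ Set.Icc 0 u) {x : Fin n → ℝ}
    (hx : x ∈ cutPolytope u θ) (habove : ∀ i, m < i → x i = θ i) (hlt : x m < θ m)
    (hgt : θ m - 1 < x m) :
    ∃ y z, x ∈ segment ℝ y z ∧ (0 ≤ y ∧ y ≤ castVec (dropAt u θ m) ∧ ∀ i, m < i → y i = θ i) ∧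
      z ∈ cutPolytope u θ ∧ ∀ i, m ≤ i → z i = θ i := by
  have hm : 1 ≤ θ m := by
    have hpos : (0 : ℝ) < θ m := (hx.1.1 m).trans_lt hlt
    exact_mod_cast hpos
  have hθ0 : 0 ≤ castVec θ := fun i => Int.cast_nonneg (hθ.1 i)
  have hu0 : 0 ≤ castVec u := hθ0.trans fun i => Int.cast_le.2 (hθ.2 i)
  have hv0 : 0 ≤ castVec (dropAt u θ m) := fun i => Int.cast_nonneg (dropAt_nonneg hθ hm i)
  obtain ⟨s, w, ⟨hs0, hs1⟩, hw, hwu, hwm⟩ :=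
    exists_eq_smul_dropAt_add_smul hθ.2 hx.1.2 habove hlt hgt
  have hzu : w ⊔ 0 ≤ castVec u := sup_le hwu hu0
  refine ⟨s⁻¹ • x ⊓ castVec (dropAt u θ m), w ⊔ 0, mem_segment_inv_smul_inf_sup_zero hs0 hs1.le hw,
    ⟨le_inf (smul_nonneg (inv_nonneg.2 hs0.le) hx.1.1) hv0, inf_le_right, fun i hi => ?_⟩,
    ⟨⟨le_sup_right, hzu⟩, fun j => ?_⟩, fun i hi => ?_⟩
  · have hθs : (θ i : ℝ) ≤ s⁻¹ * θ i :=
      le_mul_of_one_le_left (hθ0 i) ((one_le_inv₀ hs0).2 hs1.le)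
    simpa [dropAt_of_gt hi, habove i hi] using hθs
  · refine cut_nonpos_of_eq_or_eq_neg hθ (fun i => sub_le_sub_right (hzu i) _) (fun i => ?_)
      fun i => cut_nonpos_of_extrapolation hm (hx.2 i) hs1 hw hwm
    exact (max_choice (w i) 0).imp (congrArg (· - (θ i : ℝ))) fun h =>
      (congrArg (· - (θ i : ℝ)) h).trans (zero_sub _)
  · simpa [hwm i hi] using hθ.1 i

theorem eq_or_exists_lt_of_mem_cutPolytope {x : Fin n → ℝ} (hx : x ∈ cutPolytope u θ) :
    x = castVec θ ∨ ∃ m, (∀ i, m < i → x i = θ i) ∧ x m < θ m := by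
  rcases lt_trichotomy (toColex x) (toColex (castVec θ)) with hlt | heq | ⟨(m : Fin n), habove, hlt⟩
  · exact .inr hlt
  · exact .inl (toColex_inj.1 heq)
  · have habove (i : Fin n) (hi : m < i) : x i = θ i := (habove i hi).symm
    have hlt : (θ m : ℝ) < x m := hlt
    have hcut := hx.2 m
    rw [cut_sub_of_eq_above habove] at hcut
    exact absurd hlt (sub_nonpos.1 hcut).not_gt

theorem cutPolytope_subset_convexHull (hθ : θ ∈ Set.Icc 0 u) :
    cutPolytope u θ ⊆ convexHull ℝ (castVec '' colexBox u θ) := by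
  have hθ_mem : castVec θ ∈ convexHull ℝ (castVec '' colexBox u θ) :=
    subset_convexHull ℝ _ ⟨θ, ⟨hθ, le_rfl⟩, rfl⟩
  have hbelow (m : Fin n) : ∀ x ∈ cutPolytope u θ, (∀ i, m < i → x i = θ i) → x m < θ m →
      x ∈ convexHull ℝ (castVec '' colexBox u θ) := by
    induction m using WellFoundedLT.induction with
    | ind m ih =>
    intro x hx habove hlt
    rcases le_or_gt (x m) (θ m - 1) with hle | hgt
    · exact mem_convexHull_colexBox_of_le_dropAt hθ hx.1.1 (le_dropAt hx.1.2 habove hle) habove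
    · obtain ⟨y, z, hxyz, ⟨hy0, hy, hy_above⟩, hz, hzm⟩ :=
        exists_mem_segment_of_mem_cutPolytope hθ hx habove hlt hgt
      refine (convex_convexHull ℝ _).segment_subset
        (mem_convexHull_colexBox_of_le_dropAt hθ hy0 hy hy_above) ?_ hxyz
      rcases eq_or_exists_lt_of_mem_cutPolytope hz with rfl | ⟨k, hk_above, hk⟩
      · exact hθ_mem
      · exact ih k (lt_of_not_ge fun hmk => hk.ne (hzm k hmk)) z hz hk_above hk
  intro x hx
  rcases eq_or_exists_lt_of_mem_cutPolytope hx with rfl | ⟨m, habove, hlt⟩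
  · exact hθ_mem
  · exact hbelow m x hx habove hlt

theorem convexHull_colexBox (hθ : θ ∈ Set.Icc 0 u) :
    convexHull ℝ (castVec '' colexBox u θ) = cutPolytope u θ := by
  refine (convexHull_min ?_ (convex_cutPolytope u θ)).antisymm (cutPolytope_subset_convexHull hθ)
  rintro _ ⟨x, hx, rfl⟩
  exact castVec_mem_cutPolytope hθ.2 hx

theorem knapsackPolytope_eq_cutPolytope (ha : ∀ i, 0 < a i) (hu : 0 ≤ u) (hb : 0 ≤ b)
    (hsup : WeaklySuperincreasing a u) :
    knapsackPolytope a u b = cutPolytope u (greedy a u b) := by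
  rw [← convexHull_colexBox ⟨greedy_nonneg ha hu hb, greedy_le a u b⟩,
    ← knapsack_eq_colexBox ha hb hsup]
  rfl

theorem cutPolytope_eq_setOf (u θ : Fin n → ℤ) :
    cutPolytope u θ = {x : Fin n → ℝ | (∀ i, 0 ≤ x i ∧ x i ≤ u i) ∧
      ∀ j, x j + ∑ i ∈ supportAbove θ j, phi u θ j i * (x i - θ i) ≤ θ j} := by
  ext x
  refine and_congr (forall_and.symm) (forall_congr' fun j => ?_)
  rw [cut_apply, ← sub_nonpos (b := (θ j : ℝ)), ← sub_add_eq_add_sub]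
  rfl

theorem exists_matrix_cutPolytope (u θ : Fin n → ℤ) :
    ∃ (A : Matrix (Fin (3 * n)) (Fin n) ℝ) (c : Fin (3 * n) → ℝ),
      cutPolytope u θ = {x | ∀ r, ∑ i, A r i * x i ≤ c r} := by
  have hcard : Fintype.card (Fin n ⊕ Fin n ⊕ Fin n) = 3 * n := by
    simp only [Fintype.card_sum, Fintype.card_fin]
    ring
  let f : Fin n ⊕ Fin n ⊕ Fin n → (Fin n → ℝ) →ₗ[ℝ] ℝ :=
    Sum.elim (fun i => -LinearMap.proj i) (Sum.elim (fun i => LinearMap.proj i) (cut u θ))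
  let c : Fin n ⊕ Fin n ⊕ Fin n → ℝ :=
    Sum.elim 0 (Sum.elim (castVec u) fun j => cut u θ j (castVec θ))
  have hsystem : cutPolytope u θ = {x | ∀ k, f k x ≤ c k} := by
    ext x
    simp [cutPolytope, Pi.le_def, and_assoc, f, c]
  rw [hsystem]
  exact exists_matrix_setOf_forall_le (Fintype.equivFinOfCardEq hcard).symm _ _

end Polytope

end SuperincreasingKnapsack

theorem theorem1 (n : ℕ) (a u : Fin n → ℤ) (b : ℤ)
    (ha : ∀ i, 0 < a i) (hu : ∀ i, 0 < u i) (hb : 0 < b)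
    (hsup : SuperincreasingKnapsack.WeaklySuperincreasing a u)
    (θ : Fin n → ℤ) (hθ : θ = SuperincreasingKnapsack.greedy a u b) :
    SuperincreasingKnapsack.knapsackPolytope a u b =
        {x : Fin n → ℝ | (∀ i, 0 ≤ x i ∧ x i ≤ (u i : ℝ)) ∧
          ∀ j, x j + ∑ i ∈ SuperincreasingKnapsack.supportAbove θ j,
            (SuperincreasingKnapsack.phi u θ j i : ℝ) * (x i - (θ i : ℝ)) ≤ (θ j : ℝ)} ∧
      ∃ (A : Matrix (Fin (3 * n)) (Fin n) ℝ) (c : Fin (3 * n) → ℝ),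
        SuperincreasingKnapsack.knapsackPolytope a u b =
          {x : Fin n → ℝ | ∀ r, ∑ i, A r i * x i ≤ c r} := by
  have hpoly := SuperincreasingKnapsack.knapsackPolytope_eq_cutPolytope ha
    (fun i => (hu i).le) hb.le hsup
  rw [hpoly, ← hθ]
  exact ⟨SuperincreasingKnapsack.cutPolytope_eq_setOf u θ,
    SuperincreasingKnapsack.exists_matrix_cutPolytope u θ⟩
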